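/- Let $P=\{p_1,\dots,p_d\}$ and $Q=\{q_1,\dots,q_d\}$ be finite partially ordered sets with $d$ elements each. The order polytope and the chain polytope of $P$ are $$\mathcal O(P)=\{x\in[0,1]^d : x_i\ge x_j \text{ whenever } p_i\le p_j\},$$ $$\mathcal C(P)=\Big\{x\in\mathbb R^d : x_i\ge 0 \text{ for all } i,\ \sum_{p_i\in C}x_i\le 1\text{ for every chain } C\subseteq P\Big\},$$ and likewise for $Q$. (Their vertices are the indicator vectors of the poset ideals, respectively of the antichains.) For $A,B\subseteq\mathbb R^d$ let $\Gamma(A,-B)$ be the convex hull of $A\cup(-B)$, and let $\mathrm{vol}$ be Lebesgue measure on $\mathbb R^d$. A linear extension of $P$ is a permutation $i_1i_2\cdots i_d$ of $[d]=\{1,\dots,d\}$ such that $a<b$ whenever $p_{i_a}<p_{i_b}$. For $W\subseteq[d]$ let $\Delta_W(P,Q)$ be the ordinal sum of the induced subposets $\{p_i : i\in W\}$ of $P$ and $\{q_j : j\in[d]\setminus W\}$ of $Q$, with every $p_i$ below every $q_j$. Its element with index $i$ is $p_i$ if $i\in W$ and $q_i$ otherwise; with this indexing its linear extensions are again permutations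 of $[d]$, and $e(\Delta_W(P,Q))$ denotes their number. Then $$\mathrm{vol}\big(\Gamma(\mathcal O(P),-\mathcal C(Q))\big)=\sum_{W\subseteq[d]}\frac{e(\Delta_W(P,Q))}{d!}.$$ Moreover, if some permutation of $[d]$ is a linear extension of both $P$ and $Q$, then $$\mathrm{vol}\big(\Gamma(\mathcal O(P),-\mathcal O(Q))\big)=\sum_{W\subseteq[d]}\frac{e(\Delta_W(P,Q))}{d!}.$$ -/

import Mathlib

open MeasureTheory
open scoped Pointwise ENNReal Nat

namespace TwinnedPolytopes

/-! A `d`-element poset `P = {p_1, …, p_d}` is a partially ordered type `P` together with an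
enumeration `p : Fin d ≃ P` of its elements. -/

/-- The permutation `σ = i_1 i_2 ⋯ i_d` (so `i_a = σ a`) is a linear extension of
`P = {p_1, …, p_d}`: whenever `p_{i_a} < p_{i_b}` in `P`, one has `a < b`. -/
def IsLinearExtension {d : ℕ} {P : Type*} [PartialOrder P] (p : Fin d ≃ P)
    (σ : Equiv.Perm (Fin d)) : Prop :=
  ∀ a b : Fin d, p (σ a) < p (σ b) → a < b

/-- The number `e(P)` of linear extensions of `P`. -/
noncomputable def numLinearExtensions {d : ℕ} {P : Type*} [PartialOrder P] (p : Fin d ≃ P) : ℕ :=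
  Nat.card {σ : Equiv.Perm (Fin d) // IsLinearExtension p σ}

/-- Stanley's order polytope `O(P)`, in the convention in which the vertices are the
indicator vectors of the poset ideals (down-sets) of `P`. -/
def orderPolytope {d : ℕ} {P : Type*} [PartialOrder P] (p : Fin d ≃ P) : Set (Fin d → ℝ) :=
  {x | (∀ i, 0 ≤ x i ∧ x i ≤ 1) ∧ ∀ i j, p i ≤ p j → x j ≤ x i}

/-- Stanley's chain polytope `C(P)`: nonnegative vectors whose sum along every chain of `P`
is at most `1`. Its vertices are the indicator vectors of the antichains of `P`. -/
def chainPolytope {d : ℕ} {P : Type*} [PartialOrder P] (p : Fin d ≃ P) : Set (Fin d → ℝ) :=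
  {x | (∀ i, 0 ≤ x i) ∧
    ∀ c : Finset (Fin d), IsChain (· ≤ ·) (p '' (c : Set (Fin d))) → ∑ i ∈ c, x i ≤ 1}

/-- `Γ(A, -B)`: the convex hull of `A ∪ (-B)`. -/
def Gam {d : ℕ} (A B : Set (Fin d → ℝ)) : Set (Fin d → ℝ) :=
  convexHull ℝ (A ∪ -B)

/-- The induced subposet `P_W = {p_i | i ∈ W}`. -/
abbrev InducedSubposet {d : ℕ} {P : Type*} (p : Fin d ≃ P) (W : Finset (Fin d)) : Type _ :=
  {x : P // p.symm x ∈ W}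

/-- `Δ_W(P, Q)`: the ordinal sum of `P_W` (below) and of `Q` induced on the complement of `W`
(above). The order is Mathlib's lexicographic order on the disjoint union. -/
abbrev Delta {d : ℕ} {P Q : Type*} (p : Fin d ≃ P) (q : Fin d ≃ Q) (W : Finset (Fin d)) : Type _ :=
  InducedSubposet p W ⊕ₗ InducedSubposet q Wᶜ

/-- The enumeration of `Δ_W(P, Q)` by `[d]`: the element with index `i` is `p_i` if `i ∈ W`,
and `q_i` if `i ∉ W`. -/
def deltaEnum {d : ℕ} {P Q : Type*} (p : Fin d ≃ P) (q : Fin d ≃ Q) (W : Finset (Fin d)) :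
    Fin d ≃ Delta p q W where
  toFun i :=
    if h : i ∈ W then toLex (Sum.inl ⟨p i, by simpa using h⟩)
    else toLex (Sum.inr ⟨q i, by simpa using h⟩)
  invFun z := Sum.elim (fun x => p.symm x.1) (fun y => q.symm y.1) (ofLex z)
  left_inv i := by
    by_cases h : i ∈ W <;> simp [h]
  right_inv z := by
    rcases h : ofLex z with ⟨x, hx⟩ | ⟨y, hy⟩
    · obtain rfl : z = toLex (Sum.inl ⟨x, hx⟩) := by rw [← h]; rfl
      simp [hx]
    · obtain rfl : z = toLex (Sum.inr ⟨y, hy⟩) := by rw [← h]; rfl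
      have hy' : q.symm y ∉ W := by simpa using hy
      simp [hy']

end TwinnedPolytopes

namespace TwinnedPolytopes

/-! ### Triangular shears preserve Lebesgue measure -/

/-! Write M_P(u) for the maximal weight of a chain of P (`chainSup` over `Set.univ`). Both volumes
are compared with that of one body, {w : M_P(w⁺) + M_Q(w⁻) ≤ 1} (`twinnedChainBody`).

Stanley's inverse transfer map φ_P (`invTransfer`) adds to each coordinate the maximal chain weight
strictly above it. So w ↦ φ_P(w⁺) − w⁻ and w ↦ φ_P(w⁺) − φ_Q(w⁻) both have the form w + g(w). Along
a linear extension, in the second case a common one, each coordinate of g depends only on later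
coordinates of w. Such a triangular shear preserves volume (`measurePreserving_triangular`), so it
suffices that the preimage of Γ is the body; no inverse map is needed. The reason is minimality: in
any decomposition of the image as x − y with x and y in dilates of the two polytopes, φ_P(w⁺) ≤ x
coordinatewise, by induction from the top of the linear extension, with the matching bound for y.

The body is then cut along the orthants. With positive coordinates W and the other signs flipped,
M_P(w⁺) + M_Q(w⁻) is the maximal chain weight in Δ_W, because a chain of an ordinal sum is an
arbitrary pair of chains. Each piece is thus, up to a null set, the chain polytope of Δ_W. That has
the volume of the order polytope, by the same transfer map, and the order polytope is a union of
e(Δ_W) simplices of volume 1/d!. -/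

theorem measurePreserving_coordinate_shear {d : ℕ} (i : Fin d) (h : (Fin d → ℝ) → ℝ)
    (hm : Measurable h) (hi : ∀ w w' : Fin d → ℝ, (∀ j, j ≠ i → w j = w' j) → h w = h w') :
    MeasurePreserving (fun w : Fin d → ℝ => Function.update w i (w i + h w)) volume volume := by
  obtain _ | n := d
  · exact i.elim0
  have e := volume_preserving_piFinSuccAbove (fun _ : Fin (n + 1) => ℝ) i
  set E := MeasurableEquiv.piFinSuccAbove (fun _ : Fin (n + 1) => ℝ) i
  -- With coordinate `i` split off, the map translates each fibre, by an amount fixed by the other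
  -- coordinates. The inserted `0` is a dummy value for the coordinate that `h` ignores.
  have hs : MeasurePreserving
      (fun z : (Fin n → ℝ) × ℝ => (z.1, z.2 + h (i.insertNth 0 z.1)))
      (volume.prod volume) (volume.prod volume) := by
    refine (MeasurePreserving.id volume).skew_product
      (g := fun y t => t + h (i.insertNth 0 y)) ?_ ?_
    · have : Measurable fun y : Fin n → ℝ => (i.insertNth (0 : ℝ) y : Fin (n + 1) → ℝ) :=
        E.symm.measurable.comp (measurable_const.prodMk measurable_id)
      exact measurable_snd.add (hm.comp (this.comp measurable_fst))
    · exact Filter.Eventually.of_forall fun y => (measurePreserving_add_right volume _).map_eq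
  have hsw := Measure.measurePreserving_swap (μ := (volume : Measure ℝ))
    (ν := (volume : Measure (Fin n → ℝ)))
  have hsw' := Measure.measurePreserving_swap (μ := (volume : Measure (Fin n → ℝ)))
    (ν := (volume : Measure ℝ))
  have key := (e.symm E).comp (hsw'.comp (hs.comp (hsw.comp e)))
  suffices hF : (fun w : Fin (n + 1) → ℝ => Function.update w i (w i + h w)) = _ by
    rw [hF]
    exact key
  funext w
  rw [Function.comp, Function.comp, Function.comp, Function.comp, MeasurableEquiv.eq_symm_apply]
  have hw : h (i.insertNth 0 (i.removeNth w)) = h w :=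
    hi _ _ fun j hj => by
      obtain ⟨k, rfl⟩ := Fin.exists_succAbove_eq hj
      simp [Fin.removeNth]
  refine Prod.ext ?_ ?_
  · change Function.update w i (w i + h w) i = w i + h (i.insertNth 0 (i.removeNth w))
    rw [hw, Function.update_self]
  · change i.removeNth (Function.update w i (w i + h w)) = i.removeNth w
    rw [Fin.removeNth_update]

/-- The map is a composition of coordinate shears performed in the order σ 0, σ 1, …: when σ a is
updated, the later coordinates that determine its increment still hold their original values. -/
theorem measurePreserving_triangular {d : ℕ} (σ : Equiv.Perm (Fin d))
    (g : (Fin d → ℝ) → Fin d → ℝ) (hm : ∀ i, Measurable fun w => g w i)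
    (hg : ∀ a (w w' : Fin d → ℝ), (∀ b, a < b → w (σ b) = w' (σ b)) → g w (σ a) = g w' (σ a)) :
    MeasurePreserving (fun w : Fin d → ℝ => w + g w) volume volume := by
  have key : ∀ k ≤ d, MeasurePreserving
      (fun (w : Fin d → ℝ) i => if (σ.symm i : ℕ) < k then w i + g w i else w i)
      volume volume := by
    intro k
    induction k with
    | zero =>
      intro _
      simp only [Nat.not_lt_zero, if_false]
      exact MeasurePreserving.id volume
    | succ k ih =>
      intro hk
      have h1 := measurePreserving_coordinate_shear (σ ⟨k, hk⟩) (fun w => g w (σ ⟨k, hk⟩))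
        (hm _) (fun w w' hw => hg _ _ _ fun b hb => hw _ fun h => by
          rw [σ.injective h] at hb; exact lt_irrefl _ hb)
      convert h1.comp (ih (by omega)) using 1
      funext w i
      simp only [Function.comp]
      have hgk : g (fun i => if (σ.symm i : ℕ) < k then w i + g w i else w i) (σ ⟨k, hk⟩)
          = g w (σ ⟨k, hk⟩) := by
        refine hg _ _ _ fun b hb => ?_
        have : ¬ (b : ℕ) < k := by
          have : k < (b : ℕ) := hb
          omega
        simp [this]
      rw [hgk]
      by_cases hi : i = σ ⟨k, hk⟩
      · subst hi; simp
      · have : (σ.symm i : ℕ) ≠ k := fun h => hi (by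
          rw [← σ.apply_symm_apply i]; congr 1; exact Fin.ext h)
        rw [Function.update_of_ne hi]
        have h2 : (σ.symm i : ℕ) < k + 1 ↔ (σ.symm i : ℕ) < k := by omega
        simp only [h2]
  convert key d le_rfl using 1
  funext w i
  simp

/-! ### Coordinate hyperplanes and diagonals are null -/

theorem ae_ne_zero (d : ℕ) : ∀ᵐ w : Fin d → ℝ, ∀ i, w i ≠ 0 := by
  rw [ae_all_iff]
  intro i
  exact measure_mono_null (fun w hw => by simpa using hw)
    (Measure.pi_hyperplane (fun _ : Fin d => (volume : Measure ℝ)) i 0)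

theorem ae_injective (d : ℕ) : ∀ᵐ w : Fin d → ℝ, Function.Injective w := by
  have : ∀ i j : Fin d, ∀ᵐ w : Fin d → ℝ, i ≠ j → w i ≠ w j := by
    intro i j
    by_cases hij : i = j
    · simp [hij]
    let f : (Fin d → ℝ) →ₗ[ℝ] ℝ :=
      (LinearMap.proj i : (Fin d → ℝ) →ₗ[ℝ] ℝ) - LinearMap.proj j
    have h0 : volume (LinearMap.ker f : Set (Fin d → ℝ)) = 0 := by
      refine Measure.addHaar_submodule _ _ fun h => ?_
      have : Pi.single i 1 ∈ LinearMap.ker f := h ▸ Submodule.mem_top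
      simp [f, hij] at this
    refine measure_mono_null (fun w hw => ?_) h0
    simpa [f, hij, sub_eq_zero] using hw
  have h2 : ∀ᵐ w : Fin d → ℝ, ∀ i j, i ≠ j → w i ≠ w j := by
    rw [ae_all_iff]; intro i; rw [ae_all_iff]; exact this i
  filter_upwards [h2] with w hw i j hij
  by_contra h
  exact hw i j h hij

/-! ### The simplices of the cube indexed by permutations -/

/-- The points of the unit cube whose coordinates strictly decrease along `σ`. -/
def permSimplex {d : ℕ} (σ : Equiv.Perm (Fin d)) : Set (Fin d → ℝ) :=
  {x | (∀ i, 0 ≤ x i ∧ x i ≤ 1) ∧ StrictAnti (x ∘ σ)}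

theorem measurableSet_permSimplex {d : ℕ} (σ : Equiv.Perm (Fin d)) :
    MeasurableSet (permSimplex σ) := by
  have : permSimplex σ = {x : Fin d → ℝ | ∀ i, 0 ≤ x i ∧ x i ≤ 1} ∩
      {x | ∀ a b, a < b → x (σ b) < x (σ a)} := rfl
  rw [this]
  refine MeasurableSet.inter ?_ ?_
  · simp only [Set.ofPred_forall]
    refine MeasurableSet.iInter fun i => ?_
    exact (measurableSet_le measurable_const (measurable_pi_apply i)).inter
      (measurableSet_le (measurable_pi_apply i) measurable_const)
  · simp only [Set.ofPred_forall]
    refine MeasurableSet.iInter fun a => MeasurableSet.iInter fun b => MeasurableSet.iInter fun _ => ?_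
    exact measurableSet_lt (measurable_pi_apply _) (measurable_pi_apply _)

theorem permSimplex_disjoint {d : ℕ} {σ τ : Equiv.Perm (Fin d)} {x : Fin d → ℝ}
    (hσ : x ∈ permSimplex σ) (hτ : x ∈ permSimplex τ) : σ = τ := by
  have h := Tuple.unique_antitone hσ.2.antitone hτ.2.antitone
  ext1 a
  have hinj : Function.Injective x := by
    have := hσ.2.injective
    simpa using this
  exact hinj (congrFun h a)

theorem exists_mem_permSimplex {d : ℕ} {x : Fin d → ℝ} (h01 : ∀ i, 0 ≤ x i ∧ x i ≤ 1)
    (hx : Function.Injective x) : ∃ σ, x ∈ permSimplex σ := by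
  -- `Tuple.sort` sorts increasingly, hence the sign.
  refine ⟨Tuple.sort (fun i => - x i), h01, ?_⟩
  have h := Tuple.monotone_sort (fun i => - x i)
  have h' : Antitone (x ∘ Tuple.sort (fun i => - x i)) := fun a b hab => by
    have := h hab
    simpa using this
  exact h'.strictAnti_of_injective (hx.comp (Equiv.injective _))

theorem volume_permSimplex_eq {d : ℕ} (σ : Equiv.Perm (Fin d)) :
    volume (permSimplex σ) = volume (permSimplex (1 : Equiv.Perm (Fin d))) := by
  have h := volume_measurePreserving_piCongrLeft (fun _ : Fin d => ℝ) σ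
  rw [← h.measure_preimage (measurableSet_permSimplex σ).nullMeasurableSet]
  congr 1
  ext x
  have hc : ∀ a, (MeasurableEquiv.piCongrLeft (fun _ : Fin d => ℝ) σ) x (σ a) = x a := fun a =>
    Equiv.piCongrLeft_apply_apply (fun _ : Fin d => ℝ) σ x a
  constructor
  · rintro ⟨h1, h2⟩
    exact ⟨fun i => hc i ▸ h1 (σ i), fun a b hab => by simpa [hc] using h2 hab⟩
  · rintro ⟨h1, h2⟩
    refine ⟨fun i => ?_, fun a b hab => by simpa [hc] using h2 hab⟩
    obtain ⟨a, rfl⟩ := σ.surjective i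
    exact hc a ▸ h1 a

theorem volume_biUnion_permSimplex {d : ℕ} (A : Finset (Equiv.Perm (Fin d))) :
    volume (⋃ σ ∈ A, permSimplex σ) =
      A.card * volume (permSimplex (1 : Equiv.Perm (Fin d))) := by
  rw [measure_biUnion_finset]
  · simp [volume_permSimplex_eq]
  · intro σ _ τ _ hne
    exact Set.disjoint_left.2 fun x hx hy => hne (permSimplex_disjoint hx hy)
  · exact fun σ _ => measurableSet_permSimplex σ

/-- The d! simplices are disjoint, have equal volume, and cover the unit cube up to points with
repeated coordinates. -/
theorem volume_permSimplex {d : ℕ} (σ : Equiv.Perm (Fin d)) :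
    volume (permSimplex σ) = ((d ! : ℕ) : ℝ≥0∞)⁻¹ := by
  rw [volume_permSimplex_eq]
  have h1 := volume_biUnion_permSimplex (Finset.univ : Finset (Equiv.Perm (Fin d)))
  have h2 : volume (⋃ σ ∈ (Finset.univ : Finset (Equiv.Perm (Fin d))), permSimplex σ) = 1 := by
    have h3 : volume (Set.Icc (0 : Fin d → ℝ) 1) = 1 := by
      rw [Real.volume_Icc_pi]; simp
    rw [← h3]
    refine measure_congr ?_
    filter_upwards [ae_injective d] with x hx
    apply propext
    change x ∈ (⋃ σ ∈ (Finset.univ : Finset (Equiv.Perm (Fin d))), permSimplex σ) ↔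
      x ∈ Set.Icc (0 : Fin d → ℝ) 1
    simp only [Finset.mem_univ, Set.iUnion_true, Set.mem_iUnion, Set.mem_Icc]
    constructor
    · rintro ⟨σ, hσ⟩
      exact ⟨fun i => (hσ.1 i).1, fun i => (hσ.1 i).2⟩
    · rintro ⟨h0, h1⟩
      exact exists_mem_permSimplex (fun i => ⟨h0 i, h1 i⟩) hx
  rw [h2, Finset.card_univ, Fintype.card_perm, Fintype.card_fin, mul_comm] at h1
  exact ENNReal.eq_inv_of_mul_eq_one_left h1.symm

/-- A point with distinct coordinates satisfies the order inequalities exactly when the permutation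
sorting it decreasingly is a linear extension. -/
theorem volume_orderPolytope {d : ℕ} {P : Type*} [PartialOrder P] (p : Fin d ≃ P) :
    volume (orderPolytope p) = (numLinearExtensions p : ℝ≥0∞) / ((d ! : ℕ) : ℝ≥0∞) := by
  classical
  have hn : numLinearExtensions p =
      (Finset.univ.filter fun σ : Equiv.Perm (Fin d) => IsLinearExtension p σ).card := by
    rw [numLinearExtensions, Nat.card_eq_fintype_card, Fintype.card_subtype]
  rw [hn, div_eq_mul_inv, ← volume_permSimplex 1, ← volume_biUnion_permSimplex]
  refine measure_congr ?_
  filter_upwards [ae_injective d] with x hx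
  apply propext
  change x ∈ orderPolytope p ↔ x ∈ (⋃ σ ∈ Finset.univ.filter
    (fun σ : Equiv.Perm (Fin d) => IsLinearExtension p σ), permSimplex σ)
  simp only [Finset.mem_filter, Finset.mem_univ, true_and, Set.mem_iUnion, exists_prop]
  constructor
  · rintro ⟨h01, hp⟩
    obtain ⟨σ, hσ⟩ := exists_mem_permSimplex h01 hx
    refine ⟨σ, fun a b hab => ?_, hσ⟩
    by_contra hba
    have h1 := hσ.2.antitone (not_lt.1 hba)
    have h2 := hp _ _ hab.le
    exact hab.ne (congrArg p (hx (le_antisymm h1 h2)))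
  · rintro ⟨σ, hl, hσ⟩
    refine ⟨hσ.1, fun i j hij => ?_⟩
    obtain ⟨a, rfl⟩ := σ.surjective i
    obtain ⟨b, rfl⟩ := σ.surjective j
    rcases hij.eq_or_lt with h | h
    · rw [p.injective h]
    · exact hσ.2.antitone (hl a b h).le

theorem exists_isLinearExtension {d : ℕ} {P : Type*} [PartialOrder P] (p : Fin d ≃ P) :
    ∃ σ, IsLinearExtension p σ := by
  refine ⟨Tuple.sort fun i => toLinearExtension (p i), fun a b hab => ?_⟩
  by_contra hba
  have h1 := Tuple.monotone_sort (fun i => toLinearExtension (p i)) (not_lt.1 hba)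
  have h2 := toLinearExtension.monotone hab.le
  have h3 : toLinearExtension _ = toLinearExtension _ := le_antisymm h2 h1
  exact hab.ne h3

section Chains

variable {d : ℕ} {P : Type*} [PartialOrder P] (p : Fin d ≃ P)

/-! ### Maximal weights of chains and the inverse of Stanley's transfer map -/

open Classical in
/-- The maximal weight `∑ i ∈ c, u i` of a chain `c` contained in `S`. -/
noncomputable def chainSup (S : Set (Fin d)) (u : Fin d → ℝ) : ℝ :=
  (Finset.univ.filter fun c : Finset (Fin d) =>
    (c : Set (Fin d)) ⊆ S ∧ IsChain (· ≤ ·) (p '' (c : Set (Fin d)))).sup'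
    ⟨∅, by simp⟩ (fun c => ∑ i ∈ c, u i)

variable {p} in
theorem le_chainSup {S : Set (Fin d)} (u : Fin d → ℝ) {c : Finset (Fin d)}
    (hS : (c : Set (Fin d)) ⊆ S) (hc : IsChain (· ≤ ·) (p '' (c : Set (Fin d)))) :
    ∑ i ∈ c, u i ≤ chainSup p S u :=
  Finset.le_sup' (fun c : Finset (Fin d) => ∑ i ∈ c, u i) (by simp [hS, hc])

theorem exists_chainSup_eq (S : Set (Fin d)) (u : Fin d → ℝ) :
    ∃ c : Finset (Fin d), (c : Set (Fin d)) ⊆ S ∧ IsChain (· ≤ ·) (p '' (c : Set (Fin d))) ∧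
      chainSup p S u = ∑ i ∈ c, u i := by
  classical
  obtain ⟨c, hc, h⟩ := Finset.exists_mem_eq_sup' (s := Finset.univ.filter
    fun c : Finset (Fin d) => (c : Set (Fin d)) ⊆ S ∧ IsChain (· ≤ ·) (p '' (c : Set (Fin d))))
    ⟨∅, by simp⟩ (fun c => ∑ i ∈ c, u i)
  simp only [Finset.mem_filter, Finset.mem_univ, true_and] at hc
  refine ⟨c, hc.1, hc.2, ?_⟩
  rw [← h, chainSup]

variable {p} in
theorem chainSup_le {S : Set (Fin d)} {u : Fin d → ℝ} {t : ℝ}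
    (h : ∀ c : Finset (Fin d), (c : Set (Fin d)) ⊆ S →
      IsChain (· ≤ ·) (p '' (c : Set (Fin d))) → ∑ i ∈ c, u i ≤ t) : chainSup p S u ≤ t := by
  obtain ⟨c, h1, h2, h3⟩ := exists_chainSup_eq p S u
  exact h3 ▸ h c h1 h2

theorem chainSup_nonneg (S : Set (Fin d)) (u : Fin d → ℝ) : 0 ≤ chainSup p S u := by
  simpa using le_chainSup (p := p) (S := S) u (c := ∅) (by simp) (by simp)

theorem chainSup_mono (S : Set (Fin d)) {u v : Fin d → ℝ} (h : ∀ i, u i ≤ v i) :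
    chainSup p S u ≤ chainSup p S v :=
  chainSup_le fun _ h1 h2 => (Finset.sum_le_sum fun i _ => h i).trans (le_chainSup v h1 h2)

theorem chainSup_congr {S : Set (Fin d)} {u v : Fin d → ℝ} (h : ∀ i ∈ S, u i = v i) :
    chainSup p S u = chainSup p S v :=
  le_antisymm
    (chainSup_le fun _ h1 h2 =>
      (Finset.sum_congr rfl fun i hi => h i (h1 hi)).trans_le (le_chainSup v h1 h2))
    (chainSup_le fun _ h1 h2 =>
      (Finset.sum_congr rfl fun i hi => (h i (h1 hi)).symm).trans_le (le_chainSup u h1 h2))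

theorem continuous_chainSup (S : Set (Fin d)) : Continuous (chainSup p S) := by
  unfold chainSup
  exact Continuous.finset_sup'_apply _ fun c _ => by fun_prop

theorem chainSup_univ_le_iff {u : Fin d → ℝ} {t : ℝ} :
    chainSup p Set.univ u ≤ t ↔ ∀ c : Finset (Fin d),
      IsChain (· ≤ ·) (p '' (c : Set (Fin d))) → ∑ i ∈ c, u i ≤ t :=
  ⟨fun h _ hc => (le_chainSup u (Set.subset_univ _) hc).trans h,
    fun h => chainSup_le fun c _ hc => h c hc⟩

/-- The maximal weight of a chain strictly above the `i`-th element. -/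
noncomputable def chainSupAbove (u : Fin d → ℝ) (i : Fin d) : ℝ :=
  chainSup p {j | p i < p j} u

/-- The inverse of Stanley's transfer map: the maximal weight of a chain starting at the `i`-th
element. -/
noncomputable def invTransfer (u : Fin d → ℝ) (i : Fin d) : ℝ :=
  u i + chainSupAbove p u i

theorem isChain_insert_image {c : Finset (Fin d)} {i : Fin d}
    (hc : IsChain (· ≤ ·) (p '' (c : Set (Fin d))))
    (hi : (c : Set (Fin d)) ⊆ {j | p i < p j}) :
    IsChain (· ≤ ·) (p '' ((insert i c : Finset (Fin d)) : Set (Fin d))) := by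
  rw [Finset.coe_insert, Set.image_insert_eq]
  refine hc.insert ?_
  rintro _ ⟨j, hj, rfl⟩ _
  exact Or.inl (hi hj).le

variable {p} in
theorem sum_insert_above {c : Finset (Fin d)} {i : Fin d} (u : Fin d → ℝ)
    (hi : (c : Set (Fin d)) ⊆ {j | p i < p j}) :
    ∑ j ∈ insert i c, u j = u i + ∑ j ∈ c, u j :=
  Finset.sum_insert fun h => lt_irrefl _ (hi h)

variable {p} in
theorem invTransfer_le_chainSup {S : Set (Fin d)} {i : Fin d} (u : Fin d → ℝ)
    (hi : i ∈ S) (hS : {j | p i < p j} ⊆ S) : invTransfer p u i ≤ chainSup p S u := by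
  obtain ⟨c, h1, h2, h3⟩ := exists_chainSup_eq p {j | p i < p j} u
  rw [invTransfer, chainSupAbove, h3, ← sum_insert_above u h1]
  refine le_chainSup u ?_ (isChain_insert_image p h2 h1)
  rw [Finset.coe_insert]
  exact Set.insert_subset hi (h1.trans hS)

theorem invTransfer_antitone {u : Fin d → ℝ} (hu : ∀ i, 0 ≤ u i) {i j : Fin d}
    (hij : p i ≤ p j) : invTransfer p u j ≤ invTransfer p u i := by
  rcases hij.eq_or_lt with h | h
  · rw [p.injective h]
  · have h1 : invTransfer p u j ≤ chainSupAbove p u i :=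
      invTransfer_le_chainSup u h fun k hk => h.trans hk
    have h2 := hu i
    rw [invTransfer.eq_1 p u i]
    linarith

theorem invTransfer_nonneg {u : Fin d → ℝ} (hu : ∀ i, 0 ≤ u i) (i : Fin d) :
    0 ≤ invTransfer p u i :=
  add_nonneg (hu i) (chainSup_nonneg _ _ _)

/-- Split a nonempty chain at its least element j: the rest lies strictly above j, so the whole
weight is at most `invTransfer p u j`. The empty chain is why `0 ≤ t` is required. -/
theorem chainSup_le_of_invTransfer_le {S : Set (Fin d)} {u : Fin d → ℝ} {t : ℝ} (ht : 0 ≤ t)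
    (h : ∀ j ∈ S, invTransfer p u j ≤ t) : chainSup p S u ≤ t := by
  refine chainSup_le fun c h1 h2 => ?_
  rcases c.eq_empty_or_nonempty with rfl | hne
  · simpa using ht
  obtain ⟨j, hj, hmin⟩ := Finset.exists_minimalFor p c hne
  have habove : ((c.erase j : Finset (Fin d)) : Set (Fin d)) ⊆ {k | p j < p k} := by
    intro k hk
    simp only [Finset.coe_erase, Set.mem_sdiff, Set.mem_singleton_iff, Finset.mem_coe] at hk
    have hne : p j ≠ p k := fun e => hk.2 (p.injective e).symm
    rcases h2 ⟨j, hj, rfl⟩ ⟨k, hk.1, rfl⟩ hne with h | h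
    · exact lt_of_le_of_ne h hne
    · exact lt_of_le_of_ne (hmin hk.1 h) hne
  have hch : IsChain (· ≤ ·) (p '' ((c.erase j : Finset (Fin d)) : Set (Fin d))) :=
    h2.mono (Set.image_mono (by simp))
  rw [← Finset.add_sum_erase c u hj]
  have h3 : ∑ k ∈ c.erase j, u k ≤ chainSupAbove p u j := le_chainSup u habove hch
  have h4 := h j (h1 hj)
  rw [invTransfer] at h4
  linarith

/-- This is the inductive step of the minimality arguments: domination by an order-reversing `x`
strictly above i bounds the increment at i. -/
theorem chainSupAbove_le {u x : Fin d → ℝ} {i : Fin d} (hx0 : 0 ≤ x i)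
    (hx : ∀ j, p i ≤ p j → x j ≤ x i) (h : ∀ j, p i < p j → invTransfer p u j ≤ x j) :
    chainSupAbove p u i ≤ x i :=
  chainSup_le_of_invTransfer_le p hx0 fun j hj => (h j hj).trans (hx j (le_of_lt hj))

theorem measurable_chainSupAbove (i : Fin d) : Measurable fun u => chainSupAbove p u i :=
  (continuous_chainSup p _).measurable

variable {p} in
theorem chainSupAbove_congr {σ : Equiv.Perm (Fin d)} (hσ : IsLinearExtension p σ) {a : Fin d}
    {u v : Fin d → ℝ} (h : ∀ b, a < b → u (σ b) = v (σ b)) :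
    chainSupAbove p u (σ a) = chainSupAbove p v (σ a) := by
  refine chainSup_congr p fun j hj => ?_
  obtain ⟨b, rfl⟩ := σ.surjective j
  exact h b (hσ a b hj)

/-! ### The chain polytope and the order polytope have equal volume -/

theorem invTransfer_mem_orderPolytope_iff (w : Fin d → ℝ) :
    invTransfer p w ∈ orderPolytope p ↔ w ∈ chainPolytope p := by
  constructor
  · rintro ⟨h01, hp⟩
    refine ⟨fun i => ?_, (chainSup_univ_le_iff p).1
      (chainSup_le_of_invTransfer_le p zero_le_one fun j _ => (h01 j).2)⟩
    -- Taking `x` to be `invTransfer p w` itself makes the bound say exactly that `w i` is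
    -- nonnegative.
    have h : chainSupAbove p w i ≤ w i + chainSupAbove p w i :=
      chainSupAbove_le p (x := invTransfer p w) (h01 i).1 (hp i) fun j _ => le_rfl
    linarith
  · rintro ⟨h0, h1⟩
    refine ⟨fun i => ⟨invTransfer_nonneg p h0 i, ?_⟩,
      fun i j hij => invTransfer_antitone p h0 hij⟩
    exact (invTransfer_le_chainSup w (Set.mem_univ i) (Set.subset_univ _)).trans
      ((chainSup_univ_le_iff p).2 h1)

theorem convex_orderPolytope : Convex ℝ (orderPolytope p) := by
  rintro x ⟨hx, hx'⟩ y ⟨hy, hy'⟩ a b ha hb hab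
  refine ⟨fun i => ⟨?_, ?_⟩, fun i j hij => ?_⟩ <;>
    simp only [Pi.add_apply, Pi.smul_apply, smul_eq_mul]
  · have := hx i; have := hy i; nlinarith
  · have := hx i; have := hy i; nlinarith
  · have := hx' i j hij; have := hy' i j hij; nlinarith

theorem convex_chainPolytope : Convex ℝ (chainPolytope p) := by
  rintro x ⟨hx, hx'⟩ y ⟨hy, hy'⟩ a b ha hb hab
  refine ⟨fun i => ?_, fun c hc => ?_⟩ <;>
    simp only [Pi.add_apply, Pi.smul_apply, smul_eq_mul]
  · have := hx i; have := hy i; nlinarith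
  · rw [Finset.sum_add_distrib, ← Finset.mul_sum, ← Finset.mul_sum]
    have := hx' c hc; have := hy' c hc; nlinarith

theorem volume_chainPolytope :
    volume (chainPolytope p) = (numLinearExtensions p : ℝ≥0∞) / ((d ! : ℕ) : ℝ≥0∞) := by
  rw [← volume_orderPolytope]
  obtain ⟨σ, hσ⟩ := exists_isLinearExtension p
  have hmp := measurePreserving_triangular σ (chainSupAbove p) (measurable_chainSupAbove p)
    fun a w w' h => chainSupAbove_congr hσ h
  rw [← hmp.measure_preimage ((convex_orderPolytope p).nullMeasurableSet volume)]
  congr 1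
  ext w
  exact (invTransfer_mem_orderPolytope_iff p w).symm

/-! ### Scaled polytopes -/

theorem zero_mem_orderPolytope : (0 : Fin d → ℝ) ∈ orderPolytope p :=
  ⟨fun _ => ⟨le_rfl, zero_le_one⟩, fun _ _ _ => le_rfl⟩

theorem zero_mem_chainPolytope : (0 : Fin d → ℝ) ∈ chainPolytope p :=
  ⟨fun _ => le_rfl, fun _ _ => by simp⟩

theorem mem_smul_orderPolytope_iff {t : ℝ} (ht : 0 ≤ t) (x : Fin d → ℝ) :
    x ∈ t • orderPolytope p ↔
      (∀ i, 0 ≤ x i ∧ x i ≤ t) ∧ ∀ i j, p i ≤ p j → x j ≤ x i := by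
  constructor
  · rintro ⟨y, ⟨h1, h2⟩, rfl⟩
    simp only [Pi.smul_apply, smul_eq_mul]
    refine ⟨fun i => ⟨mul_nonneg ht (h1 i).1, mul_le_of_le_one_right ht (h1 i).2⟩,
      fun i j hij => mul_le_mul_of_nonneg_left (h2 i j hij) ht⟩
  · rintro ⟨h1, h2⟩
    rcases ht.eq_or_lt with rfl | ht
    · refine ⟨0, zero_mem_orderPolytope p, ?_⟩
      ext i
      simpa using le_antisymm (h1 i).1 (h1 i).2
    · refine ⟨t⁻¹ • x, ⟨fun i => ⟨?_, ?_⟩, fun i j hij => ?_⟩, ?_⟩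
      · exact mul_nonneg (inv_nonneg.2 ht.le) (h1 i).1
      · exact (inv_mul_le_one₀ ht).2 (h1 i).2
      · exact mul_le_mul_of_nonneg_left (h2 i j hij) (inv_nonneg.2 ht.le)
      · exact smul_inv_smul₀ ht.ne' x

theorem mem_smul_chainPolytope_iff {t : ℝ} (ht : 0 ≤ t) (x : Fin d → ℝ) :
    x ∈ t • chainPolytope p ↔ (∀ i, 0 ≤ x i) ∧ chainSup p Set.univ x ≤ t := by
  rw [chainSup_univ_le_iff]
  constructor
  · rintro ⟨y, ⟨h1, h2⟩, rfl⟩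
    simp only [Pi.smul_apply, smul_eq_mul, ← Finset.mul_sum]
    exact ⟨fun i => mul_nonneg ht (h1 i), fun c hc => mul_le_of_le_one_right ht (h2 c hc)⟩
  · rintro ⟨h1, h2⟩
    rcases ht.eq_or_lt with rfl | ht
    · refine ⟨0, zero_mem_chainPolytope p, ?_⟩
      ext i
      -- For t = 0 the singleton chains force every coordinate to vanish.
      have := h2 {i} (by simp)
      simpa using le_antisymm (h1 i) (by simpa using this)
    · refine ⟨t⁻¹ • x, ⟨fun i => mul_nonneg (inv_nonneg.2 ht.le) (h1 i), fun c hc => ?_⟩,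
        smul_inv_smul₀ ht.ne' x⟩
      simp only [Pi.smul_apply, smul_eq_mul, ← Finset.mul_sum]
      exact (inv_mul_le_one₀ ht).2 (h2 c hc)

end Chains

/-! ### Points of Γ(A, −B) as differences of dilates -/

theorem mem_Gam_iff {d : ℕ} {A B : Set (Fin d → ℝ)} (hA : Convex ℝ A) (hB : Convex ℝ B)
    (hA0 : A.Nonempty) (hB0 : B.Nonempty) (z : Fin d → ℝ) :
    z ∈ Gam A B ↔ ∃ s t : ℝ, 0 ≤ s ∧ 0 ≤ t ∧ s + t = 1 ∧
      ∃ x ∈ s • A, ∃ y ∈ t • B, z = x - y := by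
  rw [Gam, hA.convexHull_union hB.neg hA0 hB0.neg, mem_convexJoin]
  constructor
  · rintro ⟨a, ha, b, hb, s, t, hs, ht, hst, rfl⟩
    exact ⟨s, t, hs, ht, hst, _, ⟨a, ha, rfl⟩, _, ⟨-b, hb, rfl⟩, by simp⟩
  · rintro ⟨s, t, hs, ht, hst, _, ⟨a, ha, rfl⟩, _, ⟨b, hb, rfl⟩, rfl⟩
    exact ⟨a, ha, -b, by simpa using hb, s, t, hs, ht, hst, by simp [sub_eq_add_neg]⟩

section Twinned

variable {d : ℕ} {P Q : Type*} [PartialOrder P] [PartialOrder Q] (p : Fin d ≃ P) (q : Fin d ≃ Q)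

/-! ### Pulling back to the twinned chain body -/

/-- The body consisting of the `w` for which the maximal weight of a chain of `P` for the positive
part of `w` and that of a chain of `Q` for the negative part of `w` sum to at most `1`. -/
def twinnedChainBody : Set (Fin d → ℝ) :=
  {w | chainSup p Set.univ w⁺ + chainSup q Set.univ w⁻ ≤ 1}

theorem continuous_posPart_pi : Continuous fun w : Fin d → ℝ => w⁺ :=
  continuous_pi fun i => (continuous_apply i).sup continuous_const

theorem continuous_negPart_pi : Continuous fun w : Fin d → ℝ => w⁻ :=
  continuous_pi fun i => (continuous_apply i).neg.sup continuous_const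

theorem measurableSet_twinnedChainBody : MeasurableSet (twinnedChainBody p q) := by
  exact (isClosed_le (((continuous_chainSup p _).comp continuous_posPart_pi).add
    ((continuous_chainSup q _).comp continuous_negPart_pi)) continuous_const).measurableSet

theorem posPart_apply_nonneg (w : Fin d → ℝ) (i : Fin d) : 0 ≤ w⁺ i :=
  posPart_nonneg w i

theorem negPart_apply_nonneg (w : Fin d → ℝ) (i : Fin d) : 0 ≤ w⁻ i :=
  negPart_nonneg w i

theorem eq_posPart_apply_sub (w : Fin d → ℝ) (i : Fin d) : w i = w⁺ i - w⁻ i :=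
  congrFun (posPart_sub_negPart w).symm i

theorem posPart_apply_eq_zero_or (w : Fin d → ℝ) (i : Fin d) : w⁺ i = 0 ∨ w⁻ i = 0 := by
  simp only [Pi.posPart_apply, Pi.negPart_apply, posPart_eq_zero, negPart_eq_zero]
  exact le_total _ _

theorem perm_induction_top (σ : Equiv.Perm (Fin d)) {C : Fin d → Prop} (h : ∀ a, (∀ b, a < b → C (σ b)) → C (σ a)) (i : Fin d) : C i := by
  obtain ⟨a, rfl⟩ := σ.surjective i
  induction a using WellFoundedGT.induction with
  | ind a ih => exact h a ih

theorem invTransfer_sub_mem_Gam_order_chain_iff (w : Fin d → ℝ) :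
    invTransfer p w⁺ - w⁻ ∈ Gam (orderPolytope p) (chainPolytope q) ↔
      w ∈ twinnedChainBody p q := by
  rw [mem_Gam_iff (convex_orderPolytope p) (convex_chainPolytope q)
    ⟨0, zero_mem_orderPolytope p⟩ ⟨0, zero_mem_chainPolytope q⟩]
  constructor
  · rintro ⟨s, t, hs, ht, hst, x, hx, y, hy, hxy⟩
    rw [mem_smul_orderPolytope_iff p hs] at hx
    rw [mem_smul_chainPolytope_iff q ht] at hy
    have hz : ∀ i, invTransfer p w⁺ i - w⁻ i = x i - y i := fun i => congrFun hxy i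
    obtain ⟨σ, hσ⟩ := exists_isLinearExtension p
    -- Minimality, from the top down. Where w⁺ vanishes, only the increment remains, and it is
    -- bounded by the values of x above; where w⁻ vanishes, the transfer value equals x − y with y ≥
    -- 0.
    have hle : ∀ i, invTransfer p w⁺ i ≤ x i := by
      refine perm_induction_top σ fun a ih => ?_
      rcases posPart_apply_eq_zero_or w (σ a) with h | h
      · rw [invTransfer, h, zero_add]
        refine chainSupAbove_le p (hx.1 _).1 (hx.2 _) fun j hj => ?_
        obtain ⟨b, rfl⟩ := σ.surjective j
        exact ih b (hσ a b hj)
      · have := hz (σ a)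
        have := hy.1 (σ a)
        linarith
    have h1 : chainSup p Set.univ w⁺ ≤ s :=
      chainSup_le_of_invTransfer_le p hs fun j _ => (hle j).trans (hx.1 j).2
    have h2 : chainSup q Set.univ w⁻ ≤ t :=
      (chainSup_mono q _ fun i => by linarith [hz i, hle i]).trans hy.2
    exact (add_le_add h1 h2).trans hst.le
  · intro hw
    have hw' : chainSup p Set.univ w⁺ + chainSup q Set.univ w⁻ ≤ 1 := hw
    have hs := chainSup_nonneg p Set.univ w⁺
    have hq := chainSup_nonneg q Set.univ w⁻
    -- The least dilation factor for the P part is used; membership in the body says that the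
    -- remainder suffices for the Q part.
    refine ⟨chainSup p Set.univ w⁺, 1 - chainSup p Set.univ w⁺, hs, by linarith, by ring,
      invTransfer p w⁺, ?_, w⁻, ?_, rfl⟩
    · rw [mem_smul_orderPolytope_iff p hs]
      exact ⟨fun i => ⟨invTransfer_nonneg p (posPart_apply_nonneg w) i,
        invTransfer_le_chainSup _ (Set.mem_univ i) (Set.subset_univ _)⟩,
        fun i j hij => invTransfer_antitone p (posPart_apply_nonneg w) hij⟩
    · rw [mem_smul_chainPolytope_iff q (by linarith)]
      exact ⟨negPart_apply_nonneg w, by linarith⟩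

variable {p q} in
theorem invTransfer_sub_mem_Gam_order_order_iff {σ : Equiv.Perm (Fin d)}
    (hp : IsLinearExtension p σ) (hq : IsLinearExtension q σ) (w : Fin d → ℝ) :
    invTransfer p w⁺ - invTransfer q w⁻ ∈ Gam (orderPolytope p) (orderPolytope q) ↔
      w ∈ twinnedChainBody p q := by
  rw [mem_Gam_iff (convex_orderPolytope p) (convex_orderPolytope q)
    ⟨0, zero_mem_orderPolytope p⟩ ⟨0, zero_mem_orderPolytope q⟩]
  constructor
  · rintro ⟨s, t, hs, ht, hst, x, hx, y, hy, hxy⟩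
    rw [mem_smul_orderPolytope_iff p hs] at hx
    rw [mem_smul_orderPolytope_iff q ht] at hy
    have hz : ∀ i, invTransfer p w⁺ i - invTransfer q w⁻ i = x i - y i :=
      fun i => congrFun hxy i
    -- The two bounds must be proved together, hence the common linear extension: at each coordinate
    -- one of w⁺, w⁻ vanishes, its bound follows from the coordinates above, and the equation of
    -- differences carries it over to the other bound.
    have hle : ∀ i, invTransfer p w⁺ i ≤ x i ∧ invTransfer q w⁻ i ≤ y i := by
      refine perm_induction_top σ fun a ih => ?_
      have hz' := hz (σ a)
      have h1 : chainSupAbove p w⁺ (σ a) ≤ x (σ a) := by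
        refine chainSupAbove_le p (hx.1 _).1 (hx.2 _) fun j hj => ?_
        obtain ⟨b, rfl⟩ := σ.surjective j
        exact (ih b (hp a b hj)).1
      have h2 : chainSupAbove q w⁻ (σ a) ≤ y (σ a) := by
        refine chainSupAbove_le q (hy.1 _).1 (hy.2 _) fun j hj => ?_
        obtain ⟨b, rfl⟩ := σ.surjective j
        exact (ih b (hq a b hj)).2
      rw [invTransfer, invTransfer] at hz' ⊢
      rcases posPart_apply_eq_zero_or w (σ a) with h | h <;> rw [h] at hz' ⊢ <;>
        constructor <;> linarith
    have h1 : chainSup p Set.univ w⁺ ≤ s :=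
      chainSup_le_of_invTransfer_le p hs fun j _ => (hle j).1.trans (hx.1 j).2
    have h2 : chainSup q Set.univ w⁻ ≤ t :=
      chainSup_le_of_invTransfer_le q ht fun j _ => (hle j).2.trans (hy.1 j).2
    exact (add_le_add h1 h2).trans hst.le
  · intro hw
    have hw' : chainSup p Set.univ w⁺ + chainSup q Set.univ w⁻ ≤ 1 := hw
    have hs := chainSup_nonneg p Set.univ w⁺
    have ht := chainSup_nonneg q Set.univ w⁻
    refine ⟨chainSup p Set.univ w⁺, 1 - chainSup p Set.univ w⁺, hs, by linarith, by ring,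
      invTransfer p w⁺, ?_, invTransfer q w⁻, ?_, rfl⟩
    · rw [mem_smul_orderPolytope_iff p hs]
      exact ⟨fun i => ⟨invTransfer_nonneg p (posPart_apply_nonneg w) i,
        invTransfer_le_chainSup _ (Set.mem_univ i) (Set.subset_univ _)⟩,
        fun i j hij => invTransfer_antitone p (posPart_apply_nonneg w) hij⟩
    · rw [mem_smul_orderPolytope_iff q (by linarith)]
      refine ⟨fun i => ⟨invTransfer_nonneg q (negPart_apply_nonneg w) i, ?_⟩,
        fun i j hij => invTransfer_antitone q (negPart_apply_nonneg w) hij⟩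
      have := invTransfer_le_chainSup (p := q) w⁻ (Set.mem_univ i) (Set.subset_univ _)
      linarith

theorem nullMeasurableSet_Gam (A B : Set (Fin d → ℝ)) : NullMeasurableSet (Gam A B) :=
  (convex_convexHull ℝ _).nullMeasurableSet volume

theorem volume_Gam_order_chain :
    volume (Gam (orderPolytope p) (chainPolytope q)) = volume (twinnedChainBody p q) := by
  obtain ⟨σ, hσ⟩ := exists_isLinearExtension p
  have hmp := measurePreserving_triangular σ (fun w => chainSupAbove p w⁺)
    (fun i => (measurable_chainSupAbove p i).comp continuous_posPart_pi.measurable)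
    fun a w w' h => chainSupAbove_congr hσ fun b hb => by
      simp only [Pi.posPart_apply, h b hb]
  rw [← hmp.measure_preimage (nullMeasurableSet_Gam _ _)]
  congr 1
  ext w
  rw [← invTransfer_sub_mem_Gam_order_chain_iff p q w, Set.mem_preimage]
  have : w + chainSupAbove p w⁺ = invTransfer p w⁺ - w⁻ := by
    ext i
    simp only [Pi.add_apply, Pi.sub_apply, invTransfer]
    linarith [eq_posPart_apply_sub w i]
  rw [this]

variable {p q} in
theorem volume_Gam_order_order {σ : Equiv.Perm (Fin d)}
    (hp : IsLinearExtension p σ) (hq : IsLinearExtension q σ) :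
    volume (Gam (orderPolytope p) (orderPolytope q)) = volume (twinnedChainBody p q) := by
  have hmp := measurePreserving_triangular σ
    (fun w => chainSupAbove p w⁺ - chainSupAbove q w⁻)
    (fun i => ((measurable_chainSupAbove p i).comp continuous_posPart_pi.measurable).sub
      ((measurable_chainSupAbove q i).comp continuous_negPart_pi.measurable))
    fun a w w' h => congrArg₂ (· - ·)
      (chainSupAbove_congr hp fun b hb => by simp only [Pi.posPart_apply, h b hb])
      (chainSupAbove_congr hq fun b hb => by simp only [Pi.negPart_apply, h b hb])
  rw [← hmp.measure_preimage (nullMeasurableSet_Gam _ _)]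
  congr 1
  ext w
  rw [← invTransfer_sub_mem_Gam_order_order_iff hp hq w, Set.mem_preimage]
  have : w + (chainSupAbove p w⁺ - chainSupAbove q w⁻) =
      invTransfer p w⁺ - invTransfer q w⁻ := by
    ext i
    simp only [Pi.add_apply, Pi.sub_apply, invTransfer]
    linarith [eq_posPart_apply_sub w i]
  rw [this]

end Twinned

/-! ### Dissecting the twinned chain body into chain polytopes of ordinal sums -/

theorem deltaEnum_of_mem {d : ℕ} {P Q : Type*} (p : Fin d ≃ P) (q : Fin d ≃ Q)
    {W : Finset (Fin d)} {i : Fin d} (h : i ∈ W) :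
    deltaEnum p q W i = toLex (Sum.inl ⟨p i, by simpa using h⟩) :=
  dif_pos h

theorem deltaEnum_of_notMem {d : ℕ} {P Q : Type*} (p : Fin d ≃ P) (q : Fin d ≃ Q)
    {W : Finset (Fin d)} {i : Fin d} (h : i ∉ W) :
    deltaEnum p q W i = toLex (Sum.inr ⟨q i, by simpa using h⟩) :=
  dif_neg h

section Orthants

variable {d : ℕ} {P Q : Type*} [PartialOrder P] [PartialOrder Q] (p : Fin d ≃ P) (q : Fin d ≃ Q)

theorem deltaEnum_le_iff_of_mem {W : Finset (Fin d)} {i j : Fin d} (hi : i ∈ W) (hj : j ∈ W) :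
    deltaEnum p q W i ≤ deltaEnum p q W j ↔ p i ≤ p j := by
  rw [deltaEnum_of_mem p q hi, deltaEnum_of_mem p q hj, Sum.Lex.inl_le_inl_iff, Subtype.mk_le_mk]

theorem deltaEnum_le_iff_of_notMem {W : Finset (Fin d)} {i j : Fin d} (hi : i ∉ W)
    (hj : j ∉ W) : deltaEnum p q W i ≤ deltaEnum p q W j ↔ q i ≤ q j := by
  rw [deltaEnum_of_notMem p q hi, deltaEnum_of_notMem p q hj, Sum.Lex.inr_le_inr_iff,
    Subtype.mk_le_mk]

theorem deltaEnum_le_of_mem_of_notMem {W : Finset (Fin d)} {i j : Fin d} (hi : i ∈ W)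
    (hj : j ∉ W) : deltaEnum p q W i ≤ deltaEnum p q W j := by
  rw [deltaEnum_of_mem p q hi, deltaEnum_of_notMem p q hj]
  exact Sum.Lex.inl_le_inr _ _

theorem isChain_image_iff (c : Finset (Fin d)) :
    IsChain (· ≤ ·) (p '' (c : Set (Fin d))) ↔ ∀ i ∈ c, ∀ j ∈ c, p i ≤ p j ∨ p j ≤ p i := by
  constructor
  · exact fun h i hi j hj => h.total ⟨i, hi, rfl⟩ ⟨j, hj, rfl⟩
  · rintro h _ ⟨i, hi, rfl⟩ _ ⟨j, hj, rfl⟩ _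
    exact h i hi j hj

/-- Elements from different summands are always comparable, so the two parts of a chain impose no
condition on each other. -/
theorem isChain_deltaEnum_iff (W c : Finset (Fin d)) :
    IsChain (· ≤ ·) (deltaEnum p q W '' (c : Set (Fin d))) ↔
      IsChain (· ≤ ·) (p '' ((c ∩ W : Finset (Fin d)) : Set (Fin d))) ∧
        IsChain (· ≤ ·) (q '' ((c \ W : Finset (Fin d)) : Set (Fin d))) := by
  simp only [isChain_image_iff, Finset.mem_inter, Finset.mem_sdiff]
  constructor
  · intro h
    refine ⟨fun i hi j hj => ?_, fun i hi j hj => ?_⟩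
    · simpa only [deltaEnum_le_iff_of_mem p q hi.2 hj.2, deltaEnum_le_iff_of_mem p q hj.2 hi.2]
        using h i hi.1 j hj.1
    · simpa only [deltaEnum_le_iff_of_notMem p q hi.2 hj.2,
        deltaEnum_le_iff_of_notMem p q hj.2 hi.2] using h i hi.1 j hj.1
  · rintro ⟨h1, h2⟩ i hi j hj
    by_cases hiW : i ∈ W <;> by_cases hjW : j ∈ W
    · simpa only [deltaEnum_le_iff_of_mem p q hiW hjW, deltaEnum_le_iff_of_mem p q hjW hiW]
        using h1 i ⟨hi, hiW⟩ j ⟨hj, hjW⟩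
    · exact Or.inl (deltaEnum_le_of_mem_of_notMem p q hiW hjW)
    · exact Or.inr (deltaEnum_le_of_mem_of_notMem p q hjW hiW)
    · simpa only [deltaEnum_le_iff_of_notMem p q hiW hjW,
        deltaEnum_le_iff_of_notMem p q hjW hiW] using h2 i ⟨hi, hiW⟩ j ⟨hj, hjW⟩

/-- Flipping the signs of the coordinates outside `W`. -/
def signFlip (W : Finset (Fin d)) (w : Fin d → ℝ) (i : Fin d) : ℝ :=
  if i ∈ W then w i else - w i

theorem measurePreserving_signFlip (W : Finset (Fin d)) :
    MeasurePreserving (signFlip W) volume volume := by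
  have := volume_preserving_pi (f := fun (i : Fin d) (t : ℝ) => if i ∈ W then t else -t)
    fun i => by
      by_cases h : i ∈ W
      · simp only [h, if_true]
        exact MeasurePreserving.id volume
      · simp only [h, if_false]
        exact Measure.measurePreserving_neg volume
  exact this

theorem signFlip_eq {W : Finset (Fin d)} {w : Fin d → ℝ} (h : ∀ i, 0 ≤ signFlip W w i)
    (i : Fin d) :
    w⁺ i = (if i ∈ W then signFlip W w i else 0) ∧
      w⁻ i = if i ∈ W then 0 else signFlip W w i := by
  have hi := h i
  unfold signFlip at hi ⊢
  rw [Pi.posPart_apply, Pi.negPart_apply]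
  by_cases hW : i ∈ W
  · simp only [hW, if_true] at hi ⊢
    exact ⟨posPart_of_nonneg hi, negPart_of_nonneg hi⟩
  · simp only [hW, if_false] at hi ⊢
    exact ⟨posPart_of_nonpos (by linarith), negPart_of_nonpos (by linarith)⟩

/-- Since the chain parts in W and outside W are chosen independently, the maximum of the sum is the
sum of the maxima. Elements of a P-chain outside W, or of a Q-chain inside W, have weight zero and
can be dropped. -/
theorem chainSup_deltaEnum {W : Finset (Fin d)} {w : Fin d → ℝ}
    (h : ∀ i, 0 ≤ signFlip W w i) :
    chainSup (deltaEnum p q W) Set.univ (signFlip W w) =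
      chainSup p Set.univ w⁺ + chainSup q Set.univ w⁻ := by
  have hpos : ∀ c : Finset (Fin d), ∑ i ∈ c, w⁺ i = ∑ i ∈ c ∩ W, signFlip W w i := fun c => by
    rw [← Finset.sum_ite_mem]
    exact Finset.sum_congr rfl fun i _ => (signFlip_eq h i).1
  have hneg : ∀ c : Finset (Fin d), ∑ i ∈ c, w⁻ i = ∑ i ∈ c \ W, signFlip W w i := fun c => by
    rw [Finset.sdiff_eq_filter, Finset.sum_filter]
    refine Finset.sum_congr rfl fun i _ => (signFlip_eq h i).2.trans ?_
    by_cases hi : i ∈ W <;> simp [hi]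
  apply le_antisymm
  · refine chainSup_le fun c _ hc => ?_
    rw [isChain_deltaEnum_iff] at hc
    have h1 := le_chainSup w⁺ (Set.subset_univ _) hc.1
    have h2 := le_chainSup w⁻ (Set.subset_univ _) hc.2
    rw [hpos, Finset.inter_assoc, Finset.inter_self] at h1
    rw [hneg, sdiff_idem] at h2
    have h3 := Finset.sum_inter_add_sum_sdiff c W (signFlip W w)
    linarith
  · obtain ⟨c, -, hc, hc'⟩ := exists_chainSup_eq p Set.univ w⁺
    obtain ⟨e, -, he, he'⟩ := exists_chainSup_eq q Set.univ w⁻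
    rw [hc', he', hpos, hneg, ← Finset.sum_union
      (Finset.disjoint_left.2 fun i hi hi' =>
        (Finset.mem_sdiff.1 hi').2 (Finset.mem_inter.1 hi).2)]
    refine le_chainSup _ (Set.subset_univ _) ((isChain_deltaEnum_iff p q W _).2 ⟨?_, ?_⟩)
    · refine hc.mono (Set.image_mono fun i => ?_)
      simp only [Finset.mem_coe, Finset.mem_inter, Finset.mem_union, Finset.mem_sdiff]
      tauto
    · refine he.mono (Set.image_mono fun i => ?_)
      simp only [Finset.mem_coe, Finset.mem_inter, Finset.mem_union, Finset.mem_sdiff]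
      tauto

/-- The points whose set of positive coordinates is `W`. -/
def positiveOn (W : Finset (Fin d)) : Set (Fin d → ℝ) :=
  {w | ∀ i, 0 < w i ↔ i ∈ W}

theorem measurableSet_positiveOn (W : Finset (Fin d)) : MeasurableSet (positiveOn W) := by
  simp only [positiveOn, Set.ofPred_forall]
  refine MeasurableSet.iInter fun i => ?_
  by_cases hi : i ∈ W
  · simpa only [hi, iff_true] using measurableSet_lt measurable_const (measurable_pi_apply i)
  · simpa only [hi, iff_false, not_lt] using
      measurableSet_le (measurable_pi_apply i) measurable_const

theorem volume_twinnedChainBody_inter_positiveOn (W : Finset (Fin d)) :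
    volume (twinnedChainBody p q ∩ positiveOn W) =
      volume (chainPolytope (deltaEnum p q W)) := by
  rw [← (measurePreserving_signFlip W).measure_preimage
    ((convex_chainPolytope (deltaEnum p q W)).nullMeasurableSet volume)]
  refine measure_congr ?_
  -- Off the coordinate hyperplanes, having positive set W is the same as lying in the closed
  -- orthant that `signFlip W` maps to the nonnegative one.
  filter_upwards [ae_ne_zero d] with w hw
  apply propext
  change (w ∈ twinnedChainBody p q ∧ w ∈ positiveOn W) ↔
    signFlip W w ∈ chainPolytope (deltaEnum p q W)
  have hsign : w ∈ positiveOn W ↔ ∀ i, 0 ≤ signFlip W w i := by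
    refine forall_congr' fun i => ?_
    unfold signFlip
    have hwi := hw i
    by_cases hi : i ∈ W
    · simp only [hi, iff_true, if_true]
      exact ⟨le_of_lt, fun h => lt_of_le_of_ne h hwi.symm⟩
    · simp only [hi, iff_false, if_false, not_lt]
      exact neg_nonneg.symm
  rw [hsign, chainPolytope, and_comm]
  refine and_congr_right fun h => ?_
  rw [← chainSup_univ_le_iff, chainSup_deltaEnum p q h]
  rfl

theorem volume_twinnedChainBody :
    volume (twinnedChainBody p q) = ∑ W : Finset (Fin d),
      (numLinearExtensions (deltaEnum p q W) : ℝ≥0∞) / ((d ! : ℕ) : ℝ≥0∞) := by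
  classical
  have hunion : twinnedChainBody p q =
      ⋃ W ∈ (Finset.univ : Finset (Finset (Fin d))), twinnedChainBody p q ∩ positiveOn W := by
    ext w
    simp only [Finset.mem_univ, Set.iUnion_true, Set.mem_iUnion, Set.mem_inter_iff]
    exact ⟨fun h => ⟨Finset.univ.filter fun i => 0 < w i, h, fun i => by simp⟩,
      fun ⟨_, h, _⟩ => h⟩
  rw [hunion, measure_biUnion_finset]
  · exact Finset.sum_congr rfl fun W _ => by
      rw [volume_twinnedChainBody_inter_positiveOn, volume_chainPolytope]
  · intro W _ W' _ hne
    refine Set.disjoint_left.2 fun w hw hw' => hne ?_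
    ext i
    exact (hw.2 i).symm.trans (hw'.2 i)
  · exact fun W _ => (measurableSet_twinnedChainBody p q).inter (measurableSet_positiveOn W)

end Orthants

end TwinnedPolytopes

theorem corollary1p5 {d : ℕ} {P Q : Type*} [PartialOrder P] [PartialOrder Q]
    (p : Fin d ≃ P) (q : Fin d ≃ Q) :
    volume (TwinnedPolytopes.Gam (TwinnedPolytopes.orderPolytope p)
        (TwinnedPolytopes.chainPolytope q)) =
      ∑ W : Finset (Fin d),
        (TwinnedPolytopes.numLinearExtensions (TwinnedPolytopes.deltaEnum p q W) : ℝ≥0∞) /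
          ((d ! : ℕ) : ℝ≥0∞) ∧
    ((∃ σ : Equiv.Perm (Fin d), TwinnedPolytopes.IsLinearExtension p σ ∧
        TwinnedPolytopes.IsLinearExtension q σ) →
      volume (TwinnedPolytopes.Gam (TwinnedPolytopes.orderPolytope p)
          (TwinnedPolytopes.orderPolytope q)) =
        ∑ W : Finset (Fin d),
          (TwinnedPolytopes.numLinearExtensions (TwinnedPolytopes.deltaEnum p q W) : ℝ≥0∞) /
            ((d ! : ℕ) : ℝ≥0∞)) := by
  refine ⟨?_, ?_⟩
  · rw [TwinnedPolytopes.volume_Gam_order_chain, TwinnedPolytopes.volume_twinnedChainBody]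
  · rintro ⟨σ, hp, hq⟩
    rw [TwinnedPolytopes.volume_Gam_order_order hp hq, TwinnedPolytopes.volume_twinnedChainBody]
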